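/- Let $m,n$ be natural numbers, $f\colon\mathbb{R}^n\to\mathbb{R}\cup\{+\infty\}$, $A\in\mathbb{R}^{m\times n}$, $b\in\mathbb{R}^m$, $\varepsilon\ge 0$ and $\alpha>0$. Let $\|\cdot\|$ be the Euclidean norm and $\mathcal{C}=\{x\in\mathbb{R}^n : \|Ax-b\|\le\varepsilon\}$. Assume: (C1) $f$ is closed, convex and proper; (C2) $A$ has full row rank or $\varepsilon>0$; (C3) $b$ lies in the image of $A$; (C4) $f$ is coercive (that is, $f(x)\to+\infty$ as $\|x\|\to\infty$) or $\mathcal{C}$ is bounded; (C5) there is $x\in\operatorname{ri}(\operatorname{dom} f)$, where $\operatorname{dom} f=\{x : f(x)<+\infty\}$, such that $Ax=b$ if $\varepsilon=0$, and $\|Ax-b\|<\varepsilon$ if $\varepsilon>0$. Write $\operatorname{prox}_{\alpha f}(x)=\operatorname{argmin}_{u\in\mathbb{R}^n}\,\alpha f(u)+\tfrac12\|u-x\|^2$. Given $z^1\in\mathbb{R}^n$, the proximal projection (PP) iteration is, for $k\ge 1$, $$x^k=\begin{cases} z^k & \text{if } \|Az^k-b\|\le\varepsilon,\\ z^k-A^\top(AA^\top+\varepsilon\tau_k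 I)^{-1}(Az^k-b) & \text{otherwise,}\end{cases}\qquad z^{k+1}=z^k+\operatorname{prox}_{\alpha f}(2x^k-z^k)-x^k,$$ where, in the second case, $\tau_k>0$ is a solution $\tau$ of $1=\tau\,\|(AA^\top+\varepsilon\tau I)^{-1}(Az^k-b)\|$. Then, for every $z^1\in\mathbb{R}^n$, the iteration generates exactly one pair of sequences $\{x^k\}$, $\{z^k\}$; $x^k$ is the Euclidean projection of $z^k$ onto $\mathcal{C}$ for all $k$; both sequences converge; and the limit of $\{x^k\}$ is a minimizer of $f$ over $\mathcal{C}$. Moreover, $\|Ax^k-b\|\le\varepsilon$ for all $k$. -/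

import Mathlib

open Filter Topology

namespace PP

/-- The epigraph of an extended-real-valued function, as a subset of `E × ℝ`. -/
def epigraph {E : Type*} (f : E → EReal) : Set (E × ℝ) :=
  {p | f p.1 ≤ (p.2 : EReal)}

/-- The effective domain of an extended-real-valued function. -/
def dom {E : Type*} (f : E → EReal) : Set E :=
  {x | f x < ⊤}

/-- `f` is closed (closed epigraph), convex (convex epigraph) and proper
(never `-∞`, and not identically `+∞`). -/
structure ClosedConvexProper {n : ℕ} (f : EuclideanSpace ℝ (Fin n) → EReal) : Prop where
  closed : IsClosed (epigraph f)
  convex : Convex ℝ (epigraph f)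
  ne_bot : ∀ x, f x ≠ ⊥
  nonempty_dom : (dom f).Nonempty

/-- `f` is coercive: `f x → +∞` as `‖x‖ → ∞`. -/
def Coercive {n : ℕ} (f : EuclideanSpace ℝ (Fin n) → EReal) : Prop :=
  Tendsto f (Bornology.cobounded (EuclideanSpace ℝ (Fin n))) (𝓝 ⊤)

/-- The constraint set `{x : ‖A x - b‖ ≤ ε}`, with Euclidean norms. -/
def constraintSet {m n : ℕ} (A : Matrix (Fin m) (Fin n) ℝ) (b : EuclideanSpace ℝ (Fin m))
    (ε : ℝ) : Set (EuclideanSpace ℝ (Fin n)) :=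
  {x | ‖A.toEuclideanLin x - b‖ ≤ ε}

/-- `p` belongs to `argmin_u α f(u) + ½ ‖u - x‖²`, i.e. `p = prox_{α f}(x)`. -/
def IsProx {n : ℕ} (α : ℝ) (f : EuclideanSpace ℝ (Fin n) → EReal)
    (x p : EuclideanSpace ℝ (Fin n)) : Prop :=
  IsMinOn (fun u => (α : EReal) * f u + ((1 / 2 * ‖u - x‖ ^ 2 : ℝ) : EReal)) Set.univ p

/-- `p` belongs to `argmin_{u ∈ C} ½ ‖u - x‖²`, i.e. `p` is the projection of `x` onto `C`. -/
def IsProjection {n : ℕ} (C : Set (EuclideanSpace ℝ (Fin n)))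
    (x p : EuclideanSpace ℝ (Fin n)) : Prop :=
  p ∈ C ∧ IsMinOn (fun u => 1 / 2 * ‖u - x‖ ^ 2) C p

/-- The vector `(A Aᵀ + ε τ I)⁻¹ (A x - b)`. -/
noncomputable def resolvedResidual {m n : ℕ} (A : Matrix (Fin m) (Fin n) ℝ)
    (b : EuclideanSpace ℝ (Fin m)) (ε τ : ℝ) (x : EuclideanSpace ℝ (Fin n)) :
    EuclideanSpace ℝ (Fin m) :=
  (A * A.transpose + (ε * τ) • (1 : Matrix (Fin m) (Fin m) ℝ))⁻¹.toEuclideanLin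
    (A.toEuclideanLin x - b)

/-- `τ` is a positive solution of `1 = τ ‖(A Aᵀ + ε τ I)⁻¹ (A x - b)‖`. -/
def IsTau {m n : ℕ} (A : Matrix (Fin m) (Fin n) ℝ) (b : EuclideanSpace ℝ (Fin m)) (ε : ℝ)
    (x : EuclideanSpace ℝ (Fin n)) (τ : ℝ) : Prop :=
  0 < τ ∧ 1 = τ * ‖resolvedResidual A b ε τ x‖

/-- The sequences `x`, `z` (indexed from `0`) are generated by the proximal projection iteration
with step size `α`. -/
structure IsPPSequence {m n : ℕ} (f : EuclideanSpace ℝ (Fin n) → EReal)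
    (A : Matrix (Fin m) (Fin n) ℝ) (b : EuclideanSpace ℝ (Fin m)) (ε α : ℝ)
    (x z : ℕ → EuclideanSpace ℝ (Fin n)) : Prop where
  x_of_le : ∀ k, ‖A.toEuclideanLin (z k) - b‖ ≤ ε → x k = z k
  x_of_lt : ∀ k, ε < ‖A.toEuclideanLin (z k) - b‖ →
    ∃ τ : ℝ, IsTau A b ε (z k) τ ∧
      x k = z k - A.transpose.toEuclideanLin (resolvedResidual A b ε τ (z k))
  z_succ : ∀ k, ∃ p, IsProx α f ((2 : ℝ) • x k - z k) p ∧ z (k + 1) = z k + p - x k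

end PP


/-!
The `x`-update of the iteration is the Euclidean projection onto the constraint set `C`: its KKT
multiplier is the resolved residual, and the scalar equation for `τ` is solved by the intermediate
value theorem. Hence the iteration is Douglas-Rachford splitting for the indicator of `C` plus
`α f`. The Douglas-Rachford operator is firmly nonexpansive, so in finite dimension its iterates
converge as soon as it has a fixed point, and the projection of a fixed point onto `C` minimizes
`f` over `C`. Conversely a minimizer `x` yields the fixed point `x - v`, where `v` is a
Fenchel-Rockafellar multiplier: it exists because the relative interiors of `C` and `dom f` meet.
The proximal points of `f` exist because a subgradient of `α f` confines a sublevel set of the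
proximal objective to a ball.
-/

namespace PP

open scoped InnerProductSpace Pointwise

section FirmlyNonexpansive

theorem tendsto_of_antitone_dist {X : Type*} [PseudoMetricSpace X] {z : ℕ → X} {w : X}
    (hz : Antitone fun k => dist (z k) w) {φ : ℕ → ℕ} (hφ : Tendsto (z ∘ φ) atTop (𝓝 w)) :
    Tendsto z atTop (𝓝 w) := by
  refine Metric.tendsto_atTop.2 fun δ hδ => ?_
  obtain ⟨k, hk⟩ := (hφ.eventually (Metric.ball_mem_nhds w hδ)).exists
  exact ⟨φ k, fun j hj => (hz hj).trans_lt hk⟩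

variable {E : Type*} [NormedAddCommGroup E] {T : E → E} {w : E} {z : ℕ → E}

/-- Firmly nonexpansive self-maps of a normed group: `T` and `1 - T` jointly contract the squared
norm. In an inner product space this is equivalent to `‖T u - T v‖² ≤ ⟪u - v, T u - T v⟫`. -/
def FirmlyNonexpansive (T : E → E) : Prop :=
  ∀ u v, ‖T u - T v‖ ^ 2 + ‖(u - T u) - (v - T v)‖ ^ 2 ≤ ‖u - v‖ ^ 2

namespace FirmlyNonexpansive

theorem lipschitzWith (hT : FirmlyNonexpansive T) : LipschitzWith 1 T := by
  refine LipschitzWith.mk_one fun u v => ?_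
  rw [dist_eq_norm, dist_eq_norm, ← sq_le_sq₀ (norm_nonneg _) (norm_nonneg _)]
  linarith [hT u v, sq_nonneg ‖u - T u - (v - T v)‖]

theorem antitone_dist (hT : FirmlyNonexpansive T) (hw : T w = w)
    (hz : ∀ k, z (k + 1) = T (z k)) : Antitone fun k => dist (z k) w := by
  refine antitone_nat_of_succ_le fun k => ?_
  calc dist (z (k + 1)) w = dist (T (z k)) (T w) := by rw [hz, hw]
    _ ≤ dist (z k) w := by simpa using hT.lipschitzWith.dist_le_mul (z k) w

theorem tendsto_sub_map (hT : FirmlyNonexpansive T) (hw : T w = w)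
    (hz : ∀ k, z (k + 1) = T (z k)) : Tendsto (fun k => z k - T (z k)) atTop (𝓝 0) := by
  obtain ⟨l, hl⟩ : ∃ l, Tendsto (fun k => dist (z k) w) atTop (𝓝 l) :=
    ⟨_, tendsto_atTop_ciInf (hT.antitone_dist hw hz) ⟨0, by rintro _ ⟨k, rfl⟩; exact dist_nonneg⟩⟩
  have hdecrease : Tendsto (fun k => dist (z k) w ^ 2 - dist (z (k + 1)) w ^ 2) atTop (𝓝 0) := by
    simpa using (hl.pow 2).sub (((tendsto_add_atTop_iff_nat 1).2 hl).pow 2)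
  have hsq : Tendsto (fun k => ‖z k - T (z k)‖ ^ 2) atTop (𝓝 0) := by
    refine squeeze_zero (fun k => sq_nonneg _) (fun k => ?_) hdecrease
    have h := hT (z k) w
    rw [hw, sub_self, sub_zero] at h
    rw [dist_eq_norm, dist_eq_norm, hz]
    linarith
  simpa [tendsto_zero_iff_norm_tendsto_zero] using hsq.sqrt

theorem exists_tendsto [ProperSpace E] (hT : FirmlyNonexpansive T) (hfix : ∃ w, T w = w)
    (hz : ∀ k, z (k + 1) = T (z k)) : ∃ w, T w = w ∧ Tendsto z atTop (𝓝 w) := by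
  obtain ⟨v, hv⟩ := hfix
  obtain ⟨w, -, φ, hφ, hlim⟩ := tendsto_subseq_of_bounded
    (Metric.isBounded_closedBall (x := v) (r := dist (z 0) v))
    fun k => hT.antitone_dist hv hz (Nat.zero_le k)
  have hTw : T w = w := by
    have hsub : Tendsto (fun k => z (φ k) - T (z (φ k))) atTop (𝓝 (w - T w)) :=
      hlim.sub ((hT.lipschitzWith.continuous.tendsto w).comp hlim)
    have hzero := (hT.tendsto_sub_map hv hz).comp hφ.tendsto_atTop
    exact (sub_eq_zero.1 (tendsto_nhds_unique hsub hzero)).symm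
  exact ⟨w, hTw, tendsto_of_antitone_dist (hT.antitone_dist hTw hz) hlim⟩

end FirmlyNonexpansive

end FirmlyNonexpansive

section Prox

variable {E : Type*} [NormedAddCommGroup E] [InnerProductSpace ℝ E]
  {y y' p p' : E} {g : E → ℝ} {D : Set E}

/-- `p` is the proximal point of `y` for the convex function equal to `g` on `D` and to `+∞` off
`D`, expressed by the optimality condition `y - p ∈ ∂g(p)`; the metric projection onto `D` is the
case `g = 0`. -/
def IsProxOn (g : E → ℝ) (D : Set E) (y p : E) : Prop :=
  p ∈ D ∧ ∀ u ∈ D, ⟪y - p, u - p⟫_ℝ ≤ g u - g p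

theorem isProxOn_of_isMinOn (hg : ConvexOn ℝ D g) (hp : p ∈ D)
    (hmin : IsMinOn (fun u => g u + 1 / 2 * ‖u - y‖ ^ 2) D p) : IsProxOn g D y p := by
  refine ⟨hp, fun u hu => ?_⟩
  have hseg : ∀ t ∈ Set.Ioc (0 : ℝ) 1,
      ⟪y - p, u - p⟫_ℝ ≤ g u - g p + t * (1 / 2 * ‖u - p‖ ^ 2) := by
    rintro t ⟨ht0, ht1⟩
    have hconv := hg.2 hp hu (sub_nonneg.2 ht1) ht0.le (sub_add_cancel 1 t)
    have hle : g p + 1 / 2 * ‖p - y‖ ^ 2 ≤ _ :=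
      hmin (hg.1 hp hu (sub_nonneg.2 ht1) ht0.le (sub_add_cancel 1 t))
    have hexpand : ‖(1 - t) • p + t • u - y‖ ^ 2 =
        ‖p - y‖ ^ 2 - 2 * t * ⟪y - p, u - p⟫_ℝ + t ^ 2 * ‖u - p‖ ^ 2 := by
      rw [show (1 - t) • p + t • u - y = (p - y) + t • (u - p) by module, norm_add_sq_real,
        norm_smul, inner_smul_right, Real.norm_eq_abs, mul_pow, sq_abs, ← neg_sub y p,
        inner_neg_left]
      ring
    simp only [smul_eq_mul] at hconv
    exact le_of_mul_le_mul_left (by linarith) ht0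
  have hlim : Tendsto (fun t : ℝ => g u - g p + t * (1 / 2 * ‖u - p‖ ^ 2)) (𝓝[>] 0)
      (𝓝 (g u - g p + 0 * (1 / 2 * ‖u - p‖ ^ 2))) :=
    (Continuous.tendsto (by fun_prop) 0).mono_left nhdsWithin_le_nhds
  rw [zero_mul, add_zero] at hlim
  exact ge_of_tendsto hlim (eventually_of_mem (Ioc_mem_nhdsGT one_pos) hseg)

namespace IsProxOn

theorem isMinOn (h : IsProxOn g D y p) : IsMinOn (fun u => g u + 1 / 2 * ‖u - y‖ ^ 2) D p := by
  intro u hu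
  have hle := h.2 u hu
  have hexpand : ‖u - y‖ ^ 2 = ‖u - p‖ ^ 2 - 2 * ⟪y - p, u - p⟫_ℝ + ‖p - y‖ ^ 2 := by
    rw [← sub_sub_sub_cancel_right u y p, norm_sub_sq_real, norm_sub_rev y p, real_inner_comm]
  change g p + 1 / 2 * ‖p - y‖ ^ 2 ≤ g u + 1 / 2 * ‖u - y‖ ^ 2
  linarith [sq_nonneg ‖u - p‖]

theorem sq_norm_sub_le_inner (h : IsProxOn g D y p) (h' : IsProxOn g D y' p') :
    ‖p - p'‖ ^ 2 ≤ ⟪y - y', p - p'⟫_ℝ := by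
  have hle := h.2 p' h'.1
  have hle' := h'.2 p h.1
  have hexpand : ⟪y - p, p' - p⟫_ℝ + ⟪y' - p', p - p'⟫_ℝ =
      ‖p - p'‖ ^ 2 - ⟪y - y', p - p'⟫_ℝ := by
    rw [← neg_sub p p', inner_neg_right, ← real_inner_self_eq_norm_sq, ← inner_sub_left,
      ← inner_neg_left, ← inner_add_left]
    congr 1
    abel
  linarith

theorem norm_sub_le (h : IsProxOn g D y p) (h' : IsProxOn g D y' p') : ‖p - p'‖ ≤ ‖y - y'‖ := by
  have hle := (h.sq_norm_sub_le_inner h').trans (real_inner_le_norm _ _)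
  by_contra! hlt
  nlinarith [norm_nonneg (y - y')]

theorem eq (h : IsProxOn g D y p) (h' : IsProxOn g D y p') : p = p' := by
  simpa [sub_eq_zero] using h.norm_sub_le h'

end IsProxOn

end Prox

section DouglasRachford

theorem existsUnique_seq {α β : Type*} {r : α → β → α → Prop} (hr : ∀ a, ∃ b a', r a b a')
    (hr' : ∀ {a b a' c a''}, r a b a' → r a c a'' → b = c ∧ a' = a'') (a₀ : α) :
    ∃! s : (ℕ → β) × (ℕ → α), s.2 0 = a₀ ∧ ∀ k, r (s.2 k) (s.1 k) (s.2 (k + 1)) := by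
  choose X T hXT using hr
  refine ⟨(fun k => X (T^[k] a₀), fun k => T^[k] a₀), ⟨rfl, fun k => ?_⟩, ?_⟩
  · simpa only [Function.iterate_succ_apply'] using hXT (T^[k] a₀)
  · rintro ⟨x, z⟩ ⟨hz0, hxz⟩
    simp only at hz0 hxz
    have hz : ∀ k, z k = T^[k] a₀ := by
      intro k
      induction k with
      | zero => exact hz0
      | succ k ih => rw [(hr' (hxz k) (hXT (z k))).2, ih, Function.iterate_succ_apply']
    refine Prod.ext (funext fun k => ?_) (funext hz)
    exact (hr' (hxz k) (hXT (z k))).1.trans (congrArg X (hz k))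

variable {E : Type*} [NormedAddCommGroup E] [InnerProductSpace ℝ E]
  {z z' x w w' y : E} {h g : E → ℝ} {C D : Set E}

/-- One step `z ↦ (x, z')` of the Douglas-Rachford iteration for `h` on `C` plus `g` on `D`:
`x` is the proximal point of `z` for `h`, and `z' = z + p - x` with `p` the proximal point of the
reflection `2 x - z` for `g`. The relation is stated through `p = x + (z' - z)`. -/
structure IsDRStep (h : E → ℝ) (C : Set E) (g : E → ℝ) (D : Set E) (z x z' : E) : Prop where
  left : IsProxOn h C z x
  right : IsProxOn g D ((2 : ℝ) • x - z) (x + (z' - z))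

theorem exists_isDRStep (hh : ∀ y, ∃ p, IsProxOn h C y p) (hg : ∀ y, ∃ p, IsProxOn g D y p)
    (z : E) : ∃ x z', IsDRStep h C g D z x z' := by
  obtain ⟨x, hx⟩ := hh z
  obtain ⟨p, hp⟩ := hg ((2 : ℝ) • x - z)
  exact ⟨x, z + p - x, hx, by rwa [show x + (z + p - x - z) = p by abel]⟩

namespace IsDRStep

theorem eq (hz : IsDRStep h C g D z x z') (hw : IsDRStep h C g D z y w') : x = y ∧ z' = w' := by
  obtain rfl := hz.left.eq hw.left
  exact ⟨rfl, by simpa using hz.right.eq hw.right⟩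

theorem firmlyNonexpansive (hz : IsDRStep h C g D z x z') (hw : IsDRStep h C g D w y w') :
    ‖z' - w'‖ ^ 2 + ‖(z - z') - (w - w')‖ ^ 2 ≤ ‖z - w‖ ^ 2 := by
  have hleft := hz.left.sq_norm_sub_le_inner hw.left
  have hright := hz.right.sq_norm_sub_le_inner hw.right
  rw [show (2 : ℝ) • x - z - ((2 : ℝ) • y - w) = (2 : ℝ) • (x - y) - (z - w) by module,
    show x + (z' - z) - (y + (w' - w)) = (x - y) + ((z' - w') - (z - w)) by abel] at hright
  rw [show (z - z') - (w - w') = (z - w) - (z' - w') by abel]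
  generalize z - w = dz at *
  generalize x - y = dx at *
  generalize z' - w' = dz' at *
  simp only [norm_add_sq_real, norm_sub_sq_real, inner_sub_left, inner_sub_right,
    inner_add_right, real_inner_smul_left, real_inner_self_eq_norm_sq] at *
  linarith [real_inner_comm dz dz', real_inner_comm dz dx]

theorem isMinOn (hz : IsDRStep h C g D z x z) : IsMinOn (h + g) (C ∩ D) x := by
  rintro u ⟨huC, huD⟩
  have hleft := hz.left.2 u huC
  have hright := hz.right.2 u huD
  rw [sub_self, add_zero, show (2 : ℝ) • x - z - x = -(z - x) by module, inner_neg_left] at hright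
  change h x + g x ≤ h u + g u
  linarith

theorem exists_tendsto [ProperSpace E] (hstep : ∀ z, ∃ x z', IsDRStep h C g D z x z')
    (hfix : ∃ z x, IsDRStep h C g D z x z) {x z : ℕ → E}
    (hxz : ∀ k, IsDRStep h C g D (z k) (x k) (z (k + 1))) :
    ∃ w y, IsDRStep h C g D w y w ∧ Tendsto z atTop (𝓝 w) ∧ Tendsto x atTop (𝓝 y) := by
  choose X T hXT using hstep
  have hT : FirmlyNonexpansive T := fun u v => (hXT u).firmlyNonexpansive (hXT v)
  obtain ⟨w, hw, hlim⟩ := hT.exists_tendsto (hfix.imp fun w ⟨_, hw⟩ => ((hXT w).eq hw).2)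
    fun k => ((hxz k).eq (hXT (z k))).2
  have hstep_w : IsDRStep h C g D w (X w) w := by simpa only [hw] using hXT w
  refine ⟨w, X w, hstep_w, hlim, ?_⟩
  rw [tendsto_iff_norm_sub_tendsto_zero] at hlim ⊢
  exact squeeze_zero (fun k => norm_nonneg _)
    (fun k => (hxz k).left.norm_sub_le hstep_w.left) hlim

end IsDRStep

end DouglasRachford

section Duality

section PerturbationEpigraph

variable {E : Type*} [AddCommGroup E] {h g : E → ℝ} {C D : Set E}

/-- The pairs `(d - c, t)` with `c ∈ C`, `d ∈ D` and `g d + h c ≤ t`: up to attainment of the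
infimum, the epigraph of the perturbation function `v ↦ inf {g d + h c | d - c = v}` of Fenchel
duality, with `h` read as `+∞` off `C` and `g` as `+∞` off `D`. -/
def perturbationEpigraph (h : E → ℝ) (C : Set E) (g : E → ℝ) (D : Set E) : Set (E × ℝ) :=
  {w | ∃ d ∈ D, ∃ c ∈ C, d - c = w.1 ∧ g d + h c ≤ w.2}

theorem fst_image_perturbationEpigraph : Prod.fst '' perturbationEpigraph h C g D = D - C := by
  ext v
  constructor
  · rintro ⟨_, ⟨d, hd, c, hc, hdc, -⟩, rfl⟩
    exact ⟨d, hd, c, hc, hdc⟩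
  · rintro ⟨d, hd, c, hc, rfl⟩
    exact ⟨(_, _), ⟨d, hd, c, hc, rfl, le_rfl⟩, rfl⟩

theorem convex_perturbationEpigraph [Module ℝ E] (hh : ConvexOn ℝ C h) (hg : ConvexOn ℝ D g) :
    Convex ℝ (perturbationEpigraph h C g D) := by
  rintro ⟨_, r⟩ ⟨d, hd, c, hc, rfl, hr⟩ ⟨_, r'⟩ ⟨d', hd', c', hc', rfl, hr'⟩ a a' ha ha' haa
  refine ⟨_, hg.1 hd hd' ha ha' haa, _, hh.1 hc hc' ha ha' haa, ?_, ?_⟩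
  · simp only [Prod.smul_mk, Prod.mk_add_mk]
    module
  · have hg_le := hg.2 hd hd' ha ha' haa
    have hh_le := hh.2 hc hc' ha ha' haa
    simp only [smul_eq_mul, Prod.smul_mk, Prod.mk_add_mk] at hg_le hh_le hr hr' ⊢
    calc _ ≤ a * (g d + h c) + a' * (g d' + h c') := by linear_combination hg_le + hh_le
      _ ≤ a * r + a' * r' := by gcongr

end PerturbationEpigraph

theorem exists_linearMap_le_of_isLeast {E : Type*} [AddCommGroup E] [Module ℝ E]
    {S : Set (E × ℝ)} (hS : Convex ℝ S) (hleast : IsLeast {t | ((0 : E), t) ∈ S} 0)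
    (hcore : ∀ v ∈ Submodule.span ℝ (Prod.fst '' S), ∃ t : ℝ, 0 < t ∧ t • v ∈ Prod.fst '' S) :
    ∃ l : E →ₗ[ℝ] ℝ, ∀ w ∈ S, l w.1 ≤ w.2 := by
  -- M. Riesz extension of the height functional from `Q × ℝ`, with `Q` a complement of the span.
  obtain ⟨Q, hQ⟩ := (Submodule.span ℝ (Prod.fst '' S)).exists_isCompl
  let s : PointedCone ℝ (E × ℝ) :=
    (ConvexCone.hull ℝ S).toPointedCone (ConvexCone.subset_hull hleast.1)
  have mem_s {w : E × ℝ} : w ∈ s ↔ ∃ c : ℝ, 0 < c ∧ ∃ y ∈ S, c • y = w :=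
    ConvexCone.mem_hull_of_convex hS
  let height : E × ℝ →ₗ.[ℝ] ℝ :=
    { domain := Q.prod ⊤
      toFun := (LinearMap.snd ℝ E ℝ).comp (Submodule.subtype _) }
  have height_apply (w : height.domain) : height w = (w : E × ℝ).2 := rfl
  have hnonneg : ∀ w : height.domain, (w : E × ℝ) ∈ s → 0 ≤ height w := by
    rintro ⟨w, hw⟩ hws
    obtain ⟨c, hc, ⟨v, t⟩, hvS, hvw⟩ := mem_s.1 hws
    obtain rfl : c • (v, t) = w := hvw
    have hvQ : v ∈ Q := (Q.smul_mem_iff hc.ne').1 hw.1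
    have hv : v = 0 :=
      Submodule.disjoint_def.1 hQ.disjoint v (Submodule.subset_span ⟨_, hvS, rfl⟩) hvQ
    exact mul_nonneg hc.le (hleast.2 (hv ▸ hvS))
  have hdense : ∀ w, ∃ w' : height.domain, (w' : E × ℝ) + w ∈ s := by
    rintro ⟨v, a⟩
    obtain ⟨u, hu, q, hq, rfl⟩ := Submodule.mem_sup.1 (hQ.sup_eq_top ▸ Submodule.mem_top : v ∈ _)
    obtain ⟨t, ht, ⟨u', r⟩, huS, hu'⟩ := hcore u hu
    refine ⟨⟨(-q, t⁻¹ * r - a), Q.neg_mem hq, trivial⟩,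
      mem_s.2 ⟨t⁻¹, inv_pos.2 ht, _, huS, Prod.ext ?_ ?_⟩⟩
    · simp_all [inv_smul_smul₀ ht.ne']
    · simp
  obtain ⟨G, hG, hGs⟩ := riesz_extension s height hnonneg hdense
  refine ⟨-(G.comp (LinearMap.inl ℝ E ℝ)), fun w hw => ?_⟩
  have hpos := hGs w (ConvexCone.subset_hull hw)
  have hsnd : G (0, w.2) = w.2 :=
    (hG ⟨(0, w.2), Q.zero_mem, trivial⟩).trans (height_apply _)
  rw [show w = (w.1, 0) + (0, w.2) by simp, map_add, hsnd] at hpos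
  simpa [neg_le_iff_add_nonneg'] using hpos

section IntrinsicInterior

variable {E : Type*} [AddCommGroup E] [Module ℝ E] [TopologicalSpace E]

theorem intrinsicInterior_affineSubspace (Q : AffineSubspace ℝ E) :
    intrinsicInterior ℝ (Q : Set E) = Q := by
  have hpre : ((↑) ⁻¹' (Q : Set E) : Set (affineSpan ℝ (Q : Set E))) = Set.univ :=
    Set.eq_univ_of_forall fun y => (AffineSubspace.affineSpan_coe Q).le y.2
  rw [intrinsicInterior, hpre, interior_univ, Set.image_univ, Subtype.range_coe,
    AffineSubspace.affineSpan_coe]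

variable [ContinuousAdd E] [ContinuousSMul ℝ E] {C D : Set E} {x₀ : E}

theorem eventually_add_smul_mem_of_mem_intrinsicInterior (hx₀ : x₀ ∈ intrinsicInterior ℝ D)
    {v : E} (hv : v ∈ vectorSpan ℝ D) : ∀ᶠ t : ℝ in 𝓝 0, x₀ + t • v ∈ D := by
  obtain ⟨y, hy, rfl⟩ := mem_intrinsicInterior.1 hx₀
  have hmem : ∀ t : ℝ, (y : E) + t • v ∈ affineSpan ℝ D := fun t => by
    rw [add_comm]
    exact AffineSubspace.vadd_mem_of_mem_direction
      (by rw [direction_affineSpan]; exact Submodule.smul_mem _ _ hv) y.2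
  let γ : ℝ → affineSpan ℝ D := fun t => ⟨(y : E) + t • v, hmem t⟩
  have hγ : Continuous γ := Continuous.subtype_mk (by fun_prop) hmem
  have hγ0 : γ 0 = y := Subtype.ext (by simp [γ])
  exact hγ.continuousAt.eventually_mem (by rw [hγ0]; exact mem_interior_iff_mem_nhds.1 hy)

theorem exists_smul_mem_sub_of_mem_intrinsicInterior (hC : x₀ ∈ intrinsicInterior ℝ C)
    (hD : x₀ ∈ intrinsicInterior ℝ D) {v : E} (hv : v ∈ Submodule.span ℝ (D - C)) :
    ∃ t : ℝ, 0 < t ∧ t • v ∈ D - C := by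
  have hspan : Submodule.span ℝ (D - C) ≤ vectorSpan ℝ D ⊔ vectorSpan ℝ C := by
    rw [Submodule.span_le]
    rintro _ ⟨d, hd, c, hc, rfl⟩
    change d - c ∈ vectorSpan ℝ D ⊔ vectorSpan ℝ C
    rw [← sub_sub_sub_cancel_right d c x₀]
    exact Submodule.sub_mem _
      (Submodule.mem_sup_left (vsub_mem_vectorSpan ℝ hd (intrinsicInterior_subset hD)))
      (Submodule.mem_sup_right (vsub_mem_vectorSpan ℝ hc (intrinsicInterior_subset hC)))
  obtain ⟨d, hd, c, hc, rfl⟩ := Submodule.mem_sup.1 (hspan hv)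
  obtain ⟨t, ⟨htD, htC⟩, ht⟩ :=
    (((eventually_add_smul_mem_of_mem_intrinsicInterior hD hd).and
      (eventually_add_smul_mem_of_mem_intrinsicInterior hC
        (Submodule.neg_mem _ hc))).filter_mono nhdsWithin_le_nhds |>.and
      (self_mem_nhdsWithin (s := Set.Ioi (0 : ℝ)))).exists
  exact ⟨t, ht, _, htD, _, htC, by module⟩

theorem exists_linearMap_of_isMinOn_add {h g : E → ℝ} (hh : ConvexOn ℝ C h)
    (hg : ConvexOn ℝ D g) (hri : (intrinsicInterior ℝ C ∩ intrinsicInterior ℝ D).Nonempty)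
    {x : E} (hxC : x ∈ C) (hxD : x ∈ D) (hmin : IsMinOn (h + g) (C ∩ D) x) :
    ∃ l : E →ₗ[ℝ] ℝ, (∀ u ∈ C, h x - l (u - x) ≤ h u) ∧ ∀ u ∈ D, g x + l (u - x) ≤ g u := by
  obtain ⟨x₀, hx₀C, hx₀D⟩ := hri
  let S := perturbationEpigraph h C (fun u => g u - (g x + h x)) D
  have hS : Convex ℝ S := convex_perturbationEpigraph hh (hg.sub (concaveOn_const _ hg.1))
  have hleast : IsLeast {t | ((0 : E), t) ∈ S} 0 := by
    refine ⟨⟨x, hxD, x, hxC, sub_self x, by simp⟩, ?_⟩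
    rintro t ⟨d, hd, c, hc, hdc, ht⟩
    obtain rfl := sub_eq_zero.1 hdc
    have hle : h x + g x ≤ h d + g d := hmin ⟨hc, hd⟩
    exact le_trans (by linarith) ht
  obtain ⟨l, hl⟩ := exists_linearMap_le_of_isLeast hS hleast fun v hv => by
    rw [fst_image_perturbationEpigraph] at hv ⊢
    exact exists_smul_mem_sub_of_mem_intrinsicInterior hx₀C hx₀D hv
  refine ⟨l, fun u hu => ?_, fun u hu => ?_⟩
  · have hle := hl (x - u, _) ⟨x, hxD, u, hu, rfl, le_rfl⟩
    rw [← neg_sub, map_neg] at hle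
    linarith
  · linarith [hl (u - x, _) ⟨u, hu, x, hxC, rfl, le_rfl⟩]

end IntrinsicInterior

variable {E : Type*} [NormedAddCommGroup E] [InnerProductSpace ℝ E] [FiniteDimensional ℝ E]
  {h g : E → ℝ} {C D : Set E}

theorem exists_isDRStep_self_of_isMinOn_add (hh : ConvexOn ℝ C h) (hg : ConvexOn ℝ D g)
    (hri : (intrinsicInterior ℝ C ∩ intrinsicInterior ℝ D).Nonempty) {x : E} (hxC : x ∈ C)
    (hxD : x ∈ D) (hmin : IsMinOn (h + g) (C ∩ D) x) : ∃ z, IsDRStep h C g D z x z := by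
  obtain ⟨l, hlC, hlD⟩ := exists_linearMap_of_isMinOn_add hh hg hri hxC hxD hmin
  let v := (InnerProductSpace.toDual ℝ E).symm (LinearMap.toContinuousLinearMap l)
  have hv : ∀ u, ⟪v, u⟫_ℝ = l u := fun u => InnerProductSpace.toDual_symm_apply
  refine ⟨x - v, ⟨hxC, fun u hu => ?_⟩, ?_⟩
  · rw [sub_sub_cancel_left, inner_neg_left, hv]
    linarith [hlC u hu]
  · rw [sub_self, add_zero]
    refine ⟨hxD, fun u hu => ?_⟩
    rw [show (2 : ℝ) • x - (x - v) - x = v by module, hv]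
    linarith [hlD u hu]

theorem exists_add_inner_le_of_convexOn (hg : ConvexOn ℝ D g) (hD : D.Nonempty) :
    ∃ x₀ ∈ D, ∃ v, ∀ u ∈ D, g x₀ + ⟪v, u - x₀⟫_ℝ ≤ g u := by
  obtain ⟨x₀, hx₀⟩ := hD.intrinsicInterior hg.1
  have hx₀D := intrinsicInterior_subset hx₀
  obtain ⟨z, hz⟩ := exists_isDRStep_self_of_isMinOn_add (C := {x₀}) (h := 0)
    (convexOn_const 0 (convex_singleton x₀)) hg ⟨x₀, by simp, hx₀⟩ (Set.mem_singleton x₀) hx₀D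
    (isMinOn_iff.2 fun u hu => by rw [Set.mem_singleton_iff.1 hu.1])
  have hprox := hz.right.2
  simp only [sub_self, add_zero] at hprox
  exact ⟨x₀, hx₀D, _, fun u hu => by linarith [hprox u hu]⟩

end Duality

section ExtendedReal

variable {X : Type*} {F : X → EReal} {C : Set X} {p : X}

theorem mem_dom : p ∈ dom F ↔ F p < ⊤ :=
  Iff.rfl

theorem notMem_dom : p ∉ dom F ↔ F p = ⊤ := by
  rw [mem_dom, not_lt_top_iff]

theorem mem_dom_of_isMinOn (hne : (C ∩ dom F).Nonempty) (hmin : IsMinOn F C p) : p ∈ dom F :=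
  hne.elim fun _ hx => mem_dom.2 ((isMinOn_iff.1 hmin _ hx.1).trans_lt hx.2)

theorem isMinOn_iff_isMinOn_toReal (hF : ∀ x, F x ≠ ⊥) (hp : p ∈ dom F) :
    IsMinOn F C p ↔ IsMinOn (fun u => (F u).toReal) (C ∩ dom F) p := by
  refine ⟨fun h u hu => EReal.toReal_le_toReal (h hu.1) (hF p) hu.2.ne, fun h u huC => ?_⟩
  by_cases hu : u ∈ dom F
  · have hle : (F p).toReal ≤ (F u).toReal := h ⟨huC, hu⟩
    rwa [← EReal.coe_le_coe_iff, EReal.coe_toReal hp.ne (hF p),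
      EReal.coe_toReal hu.ne (hF u)] at hle
  · exact le_top.trans_eq (notMem_dom.1 hu).symm

theorem exists_isMinOn_of_isBounded_sublevel [PseudoMetricSpace X] [ProperSpace X]
    (hF : LowerSemicontinuous F) (hC : IsClosed C) {x₀ : X} (hx₀ : x₀ ∈ C)
    (hbdd : Bornology.IsBounded (C ∩ {x | F x ≤ F x₀})) : ∃ x ∈ C, IsMinOn F C x := by
  obtain ⟨x, ⟨hxC, hx⟩, hmin⟩ := LowerSemicontinuousOn.exists_isMinOn
    (s := C ∩ {x | F x ≤ F x₀}) ⟨x₀, hx₀, le_refl (F x₀)⟩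
    (Metric.isCompact_of_isClosed_isBounded (hC.inter (hF.isClosed_preimage (F x₀))) hbdd)
    (hF.lowerSemicontinuousOn _)
  refine ⟨x, hxC, fun u hu => ?_⟩
  rcases le_total (F u) (F x₀) with hle | hge
  · exact hmin ⟨hu, hle⟩
  · exact le_trans hx hge

end ExtendedReal

namespace ClosedConvexProper

variable {n : ℕ} {f : EuclideanSpace ℝ (Fin n) → EReal} {α : ℝ}
  {x y p : EuclideanSpace ℝ (Fin n)} {C : Set (EuclideanSpace ℝ (Fin n))}

theorem coe_toReal (hf : ClosedConvexProper f) (hx : x ∈ dom f) : ((f x).toReal : EReal) = f x :=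
  EReal.coe_toReal hx.ne (hf.ne_bot x)

theorem convexOn_toReal (hf : ClosedConvexProper f) :
    ConvexOn ℝ (dom f) fun x => (f x).toReal := by
  have hepi : ∀ x ∈ dom f, ∀ y ∈ dom f, ∀ a b : ℝ, 0 ≤ a → 0 ≤ b → a + b = 1 →
      f (a • x + b • y) ≤ ((a * (f x).toReal + b * (f y).toReal : ℝ) : EReal) := by
    intro x hx y hy a b ha hb hab
    exact hf.convex (x := (x, (f x).toReal)) (hf.coe_toReal hx).ge
      (y := (y, (f y).toReal)) (hf.coe_toReal hy).ge ha hb hab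
  refine ⟨fun x hx y hy a b ha hb hab =>
      (hepi x hx y hy a b ha hb hab).trans_lt (EReal.coe_lt_top _),
    fun x hx y hy a b ha hb hab => ?_⟩
  exact EReal.toReal_le_toReal (hepi x hx y hy a b ha hb hab) (hf.ne_bot _) (EReal.coe_ne_top _)

theorem lowerSemicontinuous (hf : ClosedConvexProper f) : LowerSemicontinuous f := by
  refine lowerSemicontinuous_iff_isClosed_preimage.2 fun y => ?_
  induction y with
  | bot => simp [Set.preimage, hf.ne_bot]
  | coe r => exact hf.closed.preimage (f := fun x => (x, r)) (by fun_prop)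
  | top => simp

theorem isMinOn_iff (hf : ClosedConvexProper f) (hα : 0 < α) (hp : p ∈ dom f) :
    IsMinOn f C p ↔ IsMinOn (0 + fun u => α * (f u).toReal) (C ∩ dom f) p := by
  rw [isMinOn_iff_isMinOn_toReal hf.ne_bot hp]
  simp only [_root_.isMinOn_iff, zero_add, mul_le_mul_iff_right₀ hα]

theorem exists_isMinOn (hf : ClosedConvexProper f) (hC : IsClosed C) (hne : (C ∩ dom f).Nonempty)
    (hbdd : Coercive f ∨ Bornology.IsBounded C) : ∃ x ∈ C, IsMinOn f C x := by
  obtain ⟨x₀, hx₀C, hx₀⟩ := hne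
  refine exists_isMinOn_of_isBounded_sublevel hf.lowerSemicontinuous hC hx₀C ?_
  rcases hbdd with hcoercive | hC_bdd
  · have hgt : ∀ᶠ x in Bornology.cobounded (EuclideanSpace ℝ (Fin n)), f x₀ < f x :=
      hcoercive.eventually_const_lt hx₀
    exact (Bornology.isBounded_compl_iff.2 hgt).subset fun x hx => Set.mem_compl <| not_lt.2 <|
      Set.mem_ofPred.1 hx.2
  · exact hC_bdd.subset Set.inter_subset_left

end ClosedConvexProper

section ProxObjective

variable {n : ℕ} {f : EuclideanSpace ℝ (Fin n) → EReal} {α : ℝ}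
  {x y p : EuclideanSpace ℝ (Fin n)}

/-- The extended-real function `α f + ½ ‖· - y‖²`, whose minimizers over the whole space are the
proximal points of `y` in the sense of `IsProx`. -/
noncomputable def proxObjective (α : ℝ) (f : EuclideanSpace ℝ (Fin n) → EReal)
    (y u : EuclideanSpace ℝ (Fin n)) : EReal :=
  (α : EReal) * f u + ((1 / 2 * ‖u - y‖ ^ 2 : ℝ) : EReal)

theorem ClosedConvexProper.proxObjective_eq_coe (hf : ClosedConvexProper f) (hx : x ∈ dom f) :
    proxObjective α f y x = ((α * (f x).toReal + 1 / 2 * ‖x - y‖ ^ 2 : ℝ) : EReal) := by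
  rw [proxObjective, EReal.coe_add, EReal.coe_mul α, hf.coe_toReal hx]

theorem ClosedConvexProper.dom_proxObjective (hf : ClosedConvexProper f) (hα : 0 < α) :
    dom (proxObjective α f y) = dom f := by
  ext x
  refine ⟨fun hx => ?_, fun hx => ?_⟩
  · by_contra htop
    refine (mem_dom.1 hx).ne ?_
    rw [proxObjective, notMem_dom.1 htop, EReal.coe_mul_top_of_pos hα, EReal.top_add_coe]
  · exact (hf.proxObjective_eq_coe hx).trans_lt (EReal.coe_lt_top _)

theorem ClosedConvexProper.proxObjective_ne_bot (hf : ClosedConvexProper f) (hα : 0 < α) :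
    proxObjective α f y x ≠ ⊥ := by
  by_cases hx : x ∈ dom f
  · rw [hf.proxObjective_eq_coe hx]
    exact EReal.coe_ne_bot _
  · rw [← hf.dom_proxObjective hα (y := y)] at hx
    exact ne_of_eq_of_ne (notMem_dom.1 hx) top_ne_bot

theorem ClosedConvexProper.lowerSemicontinuous_proxObjective (hf : ClosedConvexProper f)
    (hα : 0 < α) : LowerSemicontinuous (proxObjective α f y) := by
  have hscale : Continuous fun c : EReal => (α : EReal) * c := continuous_iff_continuousAt.2
    fun c => EReal.Tendsto.const_mul tendsto_id (.inl (EReal.coe_ne_bot α))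
      (.inl (EReal.coe_ne_top α))
  refine LowerSemicontinuous.add'
    (hscale.comp_lowerSemicontinuous hf.lowerSemicontinuous fun a b hab =>
      mul_le_mul_of_nonneg_left hab (EReal.coe_nonneg.2 hα.le))
    (Continuous.lowerSemicontinuous (continuous_coe_real_ereal.comp (by fun_prop)))
    fun u => EReal.continuousAt_add (.inr (EReal.coe_ne_bot _)) (.inr (EReal.coe_ne_top _))

theorem ClosedConvexProper.isProx_iff_isMinOn (hf : ClosedConvexProper f) (hα : 0 < α)
    (hp : p ∈ dom f) : IsProx α f y p ↔
      IsMinOn (fun u => α * (f u).toReal + 1 / 2 * ‖u - y‖ ^ 2) (dom f) p := by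
  have heq : Set.EqOn (fun u => (proxObjective α f y u).toReal)
      (fun u => α * (f u).toReal + 1 / 2 * ‖u - y‖ ^ 2) (dom f) := fun u hu => by
    simp only [hf.proxObjective_eq_coe hu, EReal.toReal_coe]
  change IsMinOn (proxObjective α f y) Set.univ p ↔ _
  rw [IsMinOn.eq_def _ (dom f), ← heq.eventuallyEq.isMinFilter_iff (heq hp),
    ← hf.dom_proxObjective hα (y := y), ← Set.univ_inter (dom _)]
  exact isMinOn_iff_isMinOn_toReal (fun u => hf.proxObjective_ne_bot hα)
    (by rwa [hf.dom_proxObjective hα])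

theorem ClosedConvexProper.isProx_iff (hf : ClosedConvexProper f) (hα : 0 < α) :
    IsProx α f y p ↔ IsProxOn (fun u => α * (f u).toReal) (dom f) y p := by
  refine ⟨fun h => ?_, fun h => (hf.isProx_iff_isMinOn hα h.1).2 h.isMinOn⟩
  have hp : p ∈ dom f := by
    rw [← hf.dom_proxObjective hα (y := y)]
    refine mem_dom_of_isMinOn ?_ h
    rw [Set.univ_inter, hf.dom_proxObjective hα]
    exact hf.nonempty_dom
  exact isProxOn_of_isMinOn (hf.convexOn_toReal.smul hα.le) hp ((hf.isProx_iff_isMinOn hα hp).1 h)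

theorem ClosedConvexProper.exists_isProx (hf : ClosedConvexProper f) (hα : 0 < α)
    (y : EuclideanSpace ℝ (Fin n)) : ∃ p, IsProx α f y p := by
  obtain ⟨x₀, hx₀, v, hv⟩ := exists_add_inner_le_of_convexOn
    (hf.convexOn_toReal.smul hα.le) hf.nonempty_dom
  have hsublevel : {x | proxObjective α f y x ≤ proxObjective α f y x₀} ⊆
      Metric.closedBall (y - v) ‖x₀ - (y - v)‖ := by
    intro u hu
    have hu_dom : u ∈ dom f := by
      rw [← hf.dom_proxObjective hα (y := y), mem_dom] at hx₀ ⊢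
      exact lt_of_le_of_lt hu hx₀
    have hle : proxObjective α f y u ≤ proxObjective α f y x₀ := hu
    rw [hf.proxObjective_eq_coe hu_dom, hf.proxObjective_eq_coe hx₀, EReal.coe_le_coe_iff] at hle
    have hsubgradient : α * (f x₀).toReal + ⟪v, u - x₀⟫_ℝ ≤ α * (f u).toReal := hv u hu_dom
    have hcomplete : ∀ w, ‖w - (y - v)‖ ^ 2 = ‖w - y‖ ^ 2 + 2 * ⟪v, w - y⟫_ℝ + ‖v‖ ^ 2 := by
      intro w
      rw [sub_sub_eq_add_sub, add_sub_right_comm, norm_add_sq_real, real_inner_comm]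
    rw [Metric.mem_closedBall, dist_eq_norm, ← sq_le_sq₀ (norm_nonneg _) (norm_nonneg _),
      hcomplete, hcomplete]
    rw [← sub_sub_sub_cancel_right u x₀ y, inner_sub_right] at hsubgradient
    linarith
  obtain ⟨p, -, hp⟩ := exists_isMinOn_of_isBounded_sublevel
    (hf.lowerSemicontinuous_proxObjective hα (y := y)) isClosed_univ (Set.mem_univ x₀)
    (Metric.isBounded_closedBall.subset (Set.inter_subset_right.trans hsublevel))
  exact ⟨p, hp⟩

end ProxObjective

section ConstraintSet

variable {m n : ℕ} {A : Matrix (Fin m) (Fin n) ℝ} {b : EuclideanSpace ℝ (Fin m)} {ε : ℝ}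
  {x z : EuclideanSpace ℝ (Fin n)}

theorem continuous_norm_toEuclideanLin_sub (A : Matrix (Fin m) (Fin n) ℝ)
    (b : EuclideanSpace ℝ (Fin m)) : Continuous fun x => ‖A.toEuclideanLin x - b‖ :=
  (A.toEuclideanLin.continuous_of_finiteDimensional.sub continuous_const).norm

theorem isClosed_constraintSet : IsClosed (constraintSet A b ε) :=
  isClosed_le (continuous_norm_toEuclideanLin_sub A b) continuous_const

theorem convex_constraintSet : Convex ℝ (constraintSet A b ε) := by
  have hpreimage : constraintSet A b ε = A.toEuclideanLin ⁻¹' Metric.closedBall b ε := by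
    ext
    simp [constraintSet, dist_eq_norm]
  rw [hpreimage]
  exact (convex_closedBall b ε).linear_preimage A.toEuclideanLin

theorem constraintSet_zero (hx : A.toEuclideanLin x = b) :
    constraintSet A b 0 = AffineSubspace.mk' x (LinearMap.ker A.toEuclideanLin) := by
  ext u
  simp [constraintSet, sub_eq_zero, hx]

theorem mem_intrinsicInterior_constraintSet (hε : 0 ≤ ε) (hzero : ε = 0 → A.toEuclideanLin x = b)
    (hpos : 0 < ε → ‖A.toEuclideanLin x - b‖ < ε) :
    x ∈ intrinsicInterior ℝ (constraintSet A b ε) := by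
  rcases hε.eq_or_lt with rfl | h
  · rw [constraintSet_zero (hzero rfl), intrinsicInterior_affineSubspace]
    exact AffineSubspace.self_mem_mk' x _
  · refine interior_subset_intrinsicInterior (mem_interior.2 ⟨{u | ‖A.toEuclideanLin u - b‖ < ε},
      fun u (hu : _ < ε) => hu.le, ?_, hpos h⟩)
    exact isOpen_lt (continuous_norm_toEuclideanLin_sub A b) continuous_const

theorem IsProxOn.isProjection {C : Set (EuclideanSpace ℝ (Fin n))} (h : IsProxOn 0 C z x) :
    IsProjection C z x :=
  ⟨h.1, by simpa only [Pi.zero_apply, zero_add] using h.isMinOn⟩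

theorem inner_toEuclideanLin_transpose (A : Matrix (Fin m) (Fin n) ℝ)
    (w : EuclideanSpace ℝ (Fin m)) (v : EuclideanSpace ℝ (Fin n)) :
    ⟪A.transpose.toEuclideanLin w, v⟫_ℝ = ⟪w, A.toEuclideanLin v⟫_ℝ := by
  rw [← Matrix.conjTranspose_eq_transpose_of_trivial,
    Matrix.toEuclideanLin_conjTranspose_eq_adjoint, LinearMap.adjoint_inner_left]

-- The KKT conditions: `w` is the multiplier of the constraint.
theorem isProxOn_constraintSet_of_multiplier {w : EuclideanSpace ℝ (Fin m)} {s : ℝ} (hs : 0 ≤ s)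
    (hres : A.toEuclideanLin (z - A.transpose.toEuclideanLin w) - b = s • w)
    (hnorm : s * ‖w‖ = ε) :
    IsProxOn 0 (constraintSet A b ε) z (z - A.transpose.toEuclideanLin w) := by
  refine ⟨?_, fun u hu => ?_⟩
  · rw [constraintSet, Set.mem_ofPred_eq, hres, norm_smul, Real.norm_of_nonneg hs, hnorm]
  · have hdiff : A.toEuclideanLin (u - (z - A.transpose.toEuclideanLin w)) =
        (A.toEuclideanLin u - b) - s • w := by
      rw [← hres, map_sub, sub_sub_sub_cancel_right]
    calc ⟪z - (z - A.transpose.toEuclideanLin w), u - (z - A.transpose.toEuclideanLin w)⟫_ℝ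
        = ⟪w, A.toEuclideanLin u - b⟫_ℝ - s * ‖w‖ ^ 2 := by
          rw [sub_sub_cancel, inner_toEuclideanLin_transpose, hdiff, inner_sub_right,
            inner_smul_right, real_inner_self_eq_norm_sq]
      _ ≤ ‖w‖ * ε - s * ‖w‖ ^ 2 := by
          gcongr
          exact (real_inner_le_norm _ _).trans (mul_le_mul_of_nonneg_left hu (norm_nonneg w))
      _ = 0 - 0 := by rw [← hnorm]; ring

end ConstraintSet

section ResolvedResidual

variable {m n : ℕ} {A : Matrix (Fin m) (Fin n) ℝ} {b : EuclideanSpace ℝ (Fin m)} {ε τ : ℝ}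
  {y z : EuclideanSpace ℝ (Fin n)}

theorem isUnit_det_mul_transpose_add_smul_one (A : Matrix (Fin m) (Fin n) ℝ) {s : ℝ} (hs : 0 < s) :
    IsUnit (A * A.transpose + s • (1 : Matrix (Fin m) (Fin m) ℝ)).det := by
  have hgram : (A * A.transpose).PosSemidef := by
    rw [← Matrix.conjTranspose_eq_transpose_of_trivial]
    exact Matrix.posSemidef_self_mul_conjTranspose A
  exact (Matrix.PosDef.posSemidef_add hgram (Matrix.PosDef.one.smul hs)).det_pos.ne'.isUnit

theorem isUnit_det_mul_transpose_of_rank_eq (hA : A.rank = m) :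
    IsUnit (A * A.transpose).det := by
  rw [← Matrix.isUnit_iff_isUnit_det, ← Matrix.mulVec_surjective_iff_isUnit]
  have hrange : LinearMap.range (A * A.transpose).mulVecLin = ⊤ := by
    apply Submodule.eq_top_of_finrank_eq
    rw [← Matrix.rank, Matrix.rank_self_mul_transpose, hA, Module.finrank_fin_fun]
  exact LinearMap.range_eq_top.1 hrange

theorem isUnit_det_of_rank_eq_or_pos (hε : 0 ≤ ε) (hA : A.rank = m ∨ 0 < ε) (hτ : 0 < τ) :
    IsUnit (A * A.transpose + (ε * τ) • (1 : Matrix (Fin m) (Fin m) ℝ)).det := by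
  rcases hε.eq_or_lt with rfl | hpos
  · rw [zero_mul, zero_smul, add_zero]
    exact isUnit_det_mul_transpose_of_rank_eq (hA.resolve_right (lt_irrefl _))
  · exact isUnit_det_mul_transpose_add_smul_one A (mul_pos hpos hτ)

theorem toEuclideanLin_resolvedResidual
    (h : IsUnit (A * A.transpose + (ε * τ) • (1 : Matrix (Fin m) (Fin m) ℝ)).det) :
    A.toEuclideanLin (A.transpose.toEuclideanLin (resolvedResidual A b ε τ z)) +
      (ε * τ) • resolvedResidual A b ε τ z = A.toEuclideanLin z - b := by
  have happly : (A * A.transpose + (ε * τ) • (1 : Matrix (Fin m) (Fin m) ℝ)).toEuclideanLin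
      (resolvedResidual A b ε τ z) = A.toEuclideanLin z - b := by
    rw [resolvedResidual, ← LinearMap.comp_apply, ← Matrix.toLpLin_mul,
      Matrix.mul_nonsing_inv _ h, Matrix.toLpLin_one, LinearMap.id_apply]
  rwa [map_add, map_smul, LinearMap.add_apply, LinearMap.smul_apply, Matrix.toLpLin_one,
    Matrix.toLpLin_mul 2 2 2, LinearMap.comp_apply, LinearMap.id_apply] at happly

theorem isProxOn_constraintSet_of_isTau (hε : 0 ≤ ε) (hA : A.rank = m ∨ 0 < ε)
    (hτ : IsTau A b ε z τ) : IsProxOn 0 (constraintSet A b ε) z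
      (z - A.transpose.toEuclideanLin (resolvedResidual A b ε τ z)) := by
  refine isProxOn_constraintSet_of_multiplier (mul_nonneg hε hτ.1.le) ?_
    (by rw [mul_assoc, ← hτ.2, mul_one])
  rw [map_sub, sub_right_comm,
    ← toEuclideanLin_resolvedResidual (isUnit_det_of_rank_eq_or_pos hε hA hτ.1),
    add_sub_cancel_left]

theorem continuousOn_resolvedResidual (hε : 0 < ε) :
    ContinuousOn (fun τ => resolvedResidual A b ε τ z) (Set.Ioi 0) := by
  have hgram : Continuous fun τ : ℝ =>
      A * A.transpose + (ε * τ) • (1 : Matrix (Fin m) (Fin m) ℝ) := by fun_prop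
  have hinv : ContinuousOn (fun τ : ℝ =>
      (A * A.transpose + (ε * τ) • (1 : Matrix (Fin m) (Fin m) ℝ))⁻¹) (Set.Ioi 0) := by
    simp only [Matrix.inv_def, Ring.inverse_eq_inv']
    refine ContinuousOn.smul (hgram.matrix_det.continuousOn.inv₀ fun τ hτ => ?_)
      hgram.matrix_adjugate.continuousOn
    exact (isUnit_det_mul_transpose_add_smul_one A (mul_pos hε hτ)).ne_zero
  have heval : Continuous fun M : Matrix (Fin m) (Fin m) ℝ =>
      M.toEuclideanLin (A.toEuclideanLin z - b) :=
    LinearMap.continuous_of_finiteDimensional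
      ((LinearMap.applyₗ (A.toEuclideanLin z - b)).comp
        (Matrix.toEuclideanLin (𝕜 := ℝ) (m := Fin m) (n := Fin m)).toLinearMap)
  exact heval.comp_continuousOn hinv

theorem mul_norm_resolvedResidual_le_one (hε : 0 < ε) (hτ : 0 < τ)
    (hy : ‖A.toEuclideanLin y - b‖ < ε)
    (hle : τ * (‖z - y‖ ^ 2 / 4) ≤ ε - ‖A.toEuclideanLin y - b‖) :
    τ * ‖resolvedResidual A b ε τ z‖ ≤ 1 := by
  have hgram := toEuclideanLin_resolvedResidual (z := z) (b := b)
    (isUnit_det_mul_transpose_add_smul_one A (mul_pos hε hτ))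
  set w := resolvedResidual A b ε τ z
  have hinner : ‖A.transpose.toEuclideanLin w‖ ^ 2 + ε * τ * ‖w‖ ^ 2 =
      ⟪A.transpose.toEuclideanLin w, z - y⟫_ℝ + ⟪w, A.toEuclideanLin y - b⟫_ℝ := by
    rw [inner_toEuclideanLin_transpose, ← inner_add_right, map_sub, sub_add_sub_cancel, ← hgram,
      inner_add_right, ← inner_toEuclideanLin_transpose, inner_smul_right,
      real_inner_self_eq_norm_sq, real_inner_self_eq_norm_sq]
  have hquad : ε * τ * ‖w‖ ^ 2 ≤ ‖z - y‖ ^ 2 / 4 + ‖w‖ * ‖A.toEuclideanLin y - b‖ := by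
    have hz := real_inner_le_norm (A.transpose.toEuclideanLin w) (z - y)
    have hb := real_inner_le_norm w (A.toEuclideanLin y - b)
    linarith [sq_nonneg (‖A.transpose.toEuclideanLin w‖ - ‖z - y‖ / 2)]
  by_contra! hlt
  have hscaled : ε * (τ * ‖w‖) ^ 2 ≤
      ε - ‖A.toEuclideanLin y - b‖ + τ * ‖w‖ * ‖A.toEuclideanLin y - b‖ := by
    linarith [mul_le_mul_of_nonneg_left hquad hτ.le]
  have hpos : 0 < (τ * ‖w‖ - 1) * (ε * (τ * ‖w‖) + (ε - ‖A.toEuclideanLin y - b‖)) :=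
    mul_pos (sub_pos.2 hlt) (add_pos (mul_pos hε (one_pos.trans hlt)) (sub_pos.2 hy))
  linarith

theorem eventually_mul_norm_resolvedResidual_le_one (hε : 0 < ε)
    (hy : ‖A.toEuclideanLin y - b‖ < ε) :
    ∀ᶠ τ in 𝓝[>] 0, τ * ‖resolvedResidual A b ε τ z‖ ≤ 1 := by
  have hlim : Tendsto (fun τ : ℝ => τ * (‖z - y‖ ^ 2 / 4)) (𝓝[>] 0) (𝓝 (0 * (‖z - y‖ ^ 2 / 4))) :=
    (tendsto_id.mul_const _).mono_left nhdsWithin_le_nhds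
  rw [zero_mul] at hlim
  filter_upwards [self_mem_nhdsWithin, hlim.eventually_le_const (sub_pos.2 hy)] with τ hτ hle
  exact mul_norm_resolvedResidual_le_one hε hτ hy hle

theorem eventually_one_le_mul_norm_resolvedResidual (hε : 0 < ε)
    (hz : ε < ‖A.toEuclideanLin z - b‖) :
    ∀ᶠ τ in atTop, 1 ≤ τ * ‖resolvedResidual A b ε τ z‖ := by
  obtain ⟨K, hK, hbound⟩ := (LinearMap.toContinuousLinearMap
    (A.toEuclideanLin ∘ₗ A.transpose.toEuclideanLin)).bound
  filter_upwards [eventually_gt_atTop 0,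
    (tendsto_id.atTop_mul_const (sub_pos.2 hz)).eventually_ge_atTop K] with τ hτ hle
  have hgram := toEuclideanLin_resolvedResidual (z := z) (b := b)
    (isUnit_det_mul_transpose_add_smul_one A (mul_pos hε hτ))
  set w := resolvedResidual A b ε τ z
  by_contra! hlt
  have hnorm : ‖A.toEuclideanLin z - b‖ ≤ (K + ε * τ) * ‖w‖ := by
    rw [← hgram, add_mul]
    refine norm_add_le_of_le (hbound w) ?_
    rw [norm_smul, Real.norm_of_nonneg (by positivity)]
  have hstrict : τ * ‖A.toEuclideanLin z - b‖ < K + ε * τ :=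
    calc τ * ‖A.toEuclideanLin z - b‖ ≤ τ * ((K + ε * τ) * ‖w‖) := by gcongr
      _ = (K + ε * τ) * (τ * ‖w‖) := by ring
      _ < (K + ε * τ) * 1 := by gcongr
      _ = K + ε * τ := mul_one _
  simp only [id_eq] at hle
  linarith

theorem exists_isTau_of_pos (hε : 0 < ε) (hy : ‖A.toEuclideanLin y - b‖ < ε)
    (hz : ε < ‖A.toEuclideanLin z - b‖) : ∃ τ, IsTau A b ε z τ := by
  obtain ⟨τ, hτ, hτ_eq⟩ := isPreconnected_Ioi.intermediate_value₂_eventually₂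
    (l₁ := 𝓝[>] (0 : ℝ)) (l₂ := atTop) inf_le_right
    (le_principal_iff.2 (Ioi_mem_atTop 0))
    (continuousOn_id.mul (continuousOn_resolvedResidual hε).norm) continuousOn_const
    (eventually_mul_norm_resolvedResidual_le_one hε hy)
    (eventually_one_le_mul_norm_resolvedResidual hε hz)
  exact ⟨τ, hτ, hτ_eq.symm⟩

theorem exists_isTau_zero (hA : A.rank = m) (hz : A.toEuclideanLin z ≠ b) :
    ∃ τ, IsTau A b 0 z τ := by
  have hconst : ∀ τ, resolvedResidual A b 0 τ z = resolvedResidual A b 0 1 z := fun τ => by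
    simp only [resolvedResidual, zero_mul]
  have hne : resolvedResidual A b 0 1 z ≠ 0 := by
    intro hw
    have hgram := toEuclideanLin_resolvedResidual (z := z) (b := b)
      (isUnit_det_of_rank_eq_or_pos le_rfl (.inl hA) one_pos)
    rw [hw, map_zero, map_zero, smul_zero, add_zero] at hgram
    exact hz (sub_eq_zero.1 hgram.symm)
  have hpos := norm_pos_iff.2 hne
  refine ⟨‖resolvedResidual A b 0 1 z‖⁻¹, inv_pos.2 hpos, ?_⟩
  rw [hconst ‖resolvedResidual A b 0 1 z‖⁻¹, inv_mul_cancel₀ hpos.ne']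

theorem exists_isTau (hε : 0 ≤ ε) (hA : A.rank = m ∨ 0 < ε)
    (hy : 0 < ε → ‖A.toEuclideanLin y - b‖ < ε) (hz : ε < ‖A.toEuclideanLin z - b‖) :
    ∃ τ, IsTau A b ε z τ := by
  rcases hε.eq_or_lt with rfl | hpos
  · exact exists_isTau_zero (hA.resolve_right (lt_irrefl _)) (sub_ne_zero.1 (norm_pos_iff.1 hz))
  · exact exists_isTau_of_pos hpos (hy hpos) hz

end ResolvedResidual

section Iteration

variable {m n : ℕ} {f : EuclideanSpace ℝ (Fin n) → EReal} {A : Matrix (Fin m) (Fin n) ℝ}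
  {b : EuclideanSpace ℝ (Fin m)} {ε α : ℝ} {y z x : EuclideanSpace ℝ (Fin n)}

/-- `x` is obtained from `z` by the `x`-update of the proximal projection iteration, as spelled
out in `IsPPSequence`. -/
def IsProjectionStep (A : Matrix (Fin m) (Fin n) ℝ) (b : EuclideanSpace ℝ (Fin m)) (ε : ℝ)
    (z x : EuclideanSpace ℝ (Fin n)) : Prop :=
  (‖A.toEuclideanLin z - b‖ ≤ ε → x = z) ∧
  (ε < ‖A.toEuclideanLin z - b‖ → ∃ τ : ℝ, IsTau A b ε z τ ∧
    x = z - A.transpose.toEuclideanLin (resolvedResidual A b ε τ z))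

theorem exists_isProjectionStep (hε : 0 ≤ ε) (hA : A.rank = m ∨ 0 < ε)
    (hy : 0 < ε → ‖A.toEuclideanLin y - b‖ < ε) (z : EuclideanSpace ℝ (Fin n)) :
    ∃ x, IsProjectionStep A b ε z x := by
  rcases le_or_gt ‖A.toEuclideanLin z - b‖ ε with hle | hgt
  · exact ⟨z, fun _ => rfl, fun hgt => absurd hle hgt.not_ge⟩
  · obtain ⟨τ, hτ⟩ := exists_isTau hε hA hy hgt
    exact ⟨_, fun hle => absurd hle hgt.not_ge, fun _ => ⟨τ, hτ, rfl⟩⟩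

theorem IsProjectionStep.isProxOn (hε : 0 ≤ ε) (hA : A.rank = m ∨ 0 < ε)
    (h : IsProjectionStep A b ε z x) : IsProxOn 0 (constraintSet A b ε) z x := by
  rcases le_or_gt ‖A.toEuclideanLin z - b‖ ε with hle | hgt
  · rw [h.1 hle]
    exact ⟨hle, fun u _ => by simp⟩
  · obtain ⟨τ, hτ, rfl⟩ := h.2 hgt
    exact isProxOn_constraintSet_of_isTau hε hA hτ

theorem isProjectionStep_iff (hε : 0 ≤ ε) (hA : A.rank = m ∨ 0 < ε)
    (hy : 0 < ε → ‖A.toEuclideanLin y - b‖ < ε) :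
    IsProjectionStep A b ε z x ↔ IsProxOn 0 (constraintSet A b ε) z x := by
  refine ⟨fun h => h.isProxOn hε hA, fun h => ?_⟩
  obtain ⟨x', hx'⟩ := exists_isProjectionStep hε hA hy z
  rwa [h.eq (hx'.isProxOn hε hA)]

theorem isPPSequence_iff (hε : 0 ≤ ε) (hα : 0 < α) (hf : ClosedConvexProper f)
    (hA : A.rank = m ∨ 0 < ε) (hy : 0 < ε → ‖A.toEuclideanLin y - b‖ < ε)
    {x z : ℕ → EuclideanSpace ℝ (Fin n)} :
    IsPPSequence f A b ε α x z ↔ ∀ k, IsDRStep 0 (constraintSet A b ε)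
      (fun u => α * (f u).toReal) (dom f) (z k) (x k) (z (k + 1)) := by
  have hproj : ∀ {z x}, IsProjectionStep A b ε z x ↔ IsProxOn 0 (constraintSet A b ε) z x :=
    isProjectionStep_iff hε hA hy
  refine ⟨fun h k => ⟨hproj.1 ⟨h.x_of_le k, h.x_of_lt k⟩, ?_⟩, fun h =>
    ⟨fun k => (hproj.2 (h k).left).1, fun k => (hproj.2 (h k).left).2, fun k =>
      ⟨x k + (z (k + 1) - z k), (hf.isProx_iff hα).2 (h k).right, by abel⟩⟩⟩
  obtain ⟨p, hp, hz⟩ := h.z_succ k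
  rw [hz, show x k + (z k + p - x k - z k) = p by abel]
  exact (hf.isProx_iff hα).1 hp

end Iteration

end PP

theorem theorem1_general {m n : ℕ} (f : EuclideanSpace ℝ (Fin n) → EReal)
    (A : Matrix (Fin m) (Fin n) ℝ) (b : EuclideanSpace ℝ (Fin m)) (ε α : ℝ)
    (hε : 0 ≤ ε) (hα : 0 < α)
    (hC1 : PP.ClosedConvexProper f)
    (hC2 : A.rank = m ∨ 0 < ε)
    (hmin : ∃ x ∈ PP.constraintSet A b ε, IsMinOn f (PP.constraintSet A b ε) x)
    (hC5 : ∃ x ∈ intrinsicInterior ℝ (PP.dom f),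
      (ε = 0 → A.toEuclideanLin x = b) ∧ (0 < ε → ‖A.toEuclideanLin x - b‖ < ε)) :
    (∀ z₁ : EuclideanSpace ℝ (Fin n),
      ∃! s : (ℕ → EuclideanSpace ℝ (Fin n)) × (ℕ → EuclideanSpace ℝ (Fin n)),
        s.2 0 = z₁ ∧ PP.IsPPSequence f A b ε α s.1 s.2) ∧
    ∀ x z : ℕ → EuclideanSpace ℝ (Fin n), PP.IsPPSequence f A b ε α x z →
      (∃ zlim, Tendsto z atTop (𝓝 zlim)) ∧
      (∃ xlim, Tendsto x atTop (𝓝 xlim) ∧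
        xlim ∈ PP.constraintSet A b ε ∧ IsMinOn f (PP.constraintSet A b ε) xlim) ∧
      (∀ k, PP.IsProjection (PP.constraintSet A b ε) (z k) (x k)) ∧
      (∀ k, ‖A.toEuclideanLin (x k) - b‖ ≤ ε) := by
  obtain ⟨y, hy, hy_zero, hy_pos⟩ := hC5
  have hyC := PP.mem_intrinsicInterior_constraintSet hε hy_zero hy_pos
  have hstep : ∀ z, ∃ x z', PP.IsDRStep 0 (PP.constraintSet A b ε) (fun u => α * (f u).toReal)
      (PP.dom f) z x z' := PP.exists_isDRStep
    (fun z => (PP.exists_isProjectionStep hε hC2 hy_pos z).imp fun _ h => h.isProxOn hε hC2)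
    (fun z => (hC1.exists_isProx hα z).imp fun _ => (hC1.isProx_iff hα).1)
  simp only [PP.isPPSequence_iff hε hα hC1 hC2 hy_pos]
  refine ⟨PP.existsUnique_seq hstep PP.IsDRStep.eq, fun x z hxz => ?_⟩
  have hfix : ∃ z x, PP.IsDRStep 0 (PP.constraintSet A b ε) (fun u => α * (f u).toReal)
      (PP.dom f) z x z := by
    obtain ⟨x, hxC, hx⟩ := hmin
    have hx_dom := PP.mem_dom_of_isMinOn
      ⟨y, intrinsicInterior_subset hyC, intrinsicInterior_subset hy⟩ hx
    obtain ⟨z, hz⟩ := PP.exists_isDRStep_self_of_isMinOn_add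
      (convexOn_const 0 PP.convex_constraintSet) (hC1.convexOn_toReal.smul hα.le) ⟨y, hyC, hy⟩
      hxC hx_dom ((hC1.isMinOn_iff hα hx_dom).1 hx)
    exact ⟨z, x, hz⟩
  obtain ⟨w, xlim, hw, hz, hx⟩ := PP.IsDRStep.exists_tendsto hstep hfix hxz
  have hx_dom : xlim ∈ PP.dom f := by simpa using hw.right.1
  exact ⟨⟨w, hz⟩, ⟨xlim, hx, hw.left.1, (hC1.isMinOn_iff hα hx_dom).2 hw.isMinOn⟩,
    fun k => (hxz k).left.isProjection, fun k => (hxz k).left.1⟩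

theorem theorem1 {m n : ℕ} (f : EuclideanSpace ℝ (Fin n) → EReal)
    (A : Matrix (Fin m) (Fin n) ℝ) (b : EuclideanSpace ℝ (Fin m)) (ε α : ℝ)
    (hε : 0 ≤ ε) (hα : 0 < α)
    (hC1 : PP.ClosedConvexProper f)
    (hC2 : A.rank = m ∨ 0 < ε)
    (hC3 : b ∈ LinearMap.range A.toEuclideanLin)
    (hC4 : PP.Coercive f ∨ Bornology.IsBounded (PP.constraintSet A b ε))
    (hC5 : ∃ x ∈ intrinsicInterior ℝ (PP.dom f),
      (ε = 0 → A.toEuclideanLin x = b) ∧ (0 < ε → ‖A.toEuclideanLin x - b‖ < ε)) :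
    -- from every starting point the iteration is well defined
    (∀ z₁ : EuclideanSpace ℝ (Fin n),
      ∃! s : (ℕ → EuclideanSpace ℝ (Fin n)) × (ℕ → EuclideanSpace ℝ (Fin n)),
        s.2 0 = z₁ ∧ PP.IsPPSequence f A b ε α s.1 s.2) ∧
    -- and whatever it generates converges, with feasible iterates
    ∀ x z : ℕ → EuclideanSpace ℝ (Fin n), PP.IsPPSequence f A b ε α x z →
      (∃ zlim, Tendsto z atTop (𝓝 zlim)) ∧
      (∃ xlim, Tendsto x atTop (𝓝 xlim) ∧
        xlim ∈ PP.constraintSet A b ε ∧ IsMinOn f (PP.constraintSet A b ε) xlim) ∧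
      (∀ k, PP.IsProjection (PP.constraintSet A b ε) (z k) (x k)) ∧
      (∀ k, ‖A.toEuclideanLin (x k) - b‖ ≤ ε) := by
  obtain ⟨y, hy, hy_zero, hy_pos⟩ := hC5
  have hyC := PP.mem_intrinsicInterior_constraintSet hε hy_zero hy_pos
  exact theorem1_general f A b ε α hε hα hC1 hC2 (hC1.exists_isMinOn PP.isClosed_constraintSet
    ⟨y, intrinsicInterior_subset hyC, intrinsicInterior_subset hy⟩ hC4) ⟨y, hy, hy_zero, hy_pos⟩
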